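/- Lemma 5.1 (comparison principle). Let $s\in(0,1)$, $N\in\mathbb N$ with $N>2s$, and let $V:\mathbb R^N\to[0,\infty)$ be continuous. Let $$\dot H^s(\mathbb R^N)=\Big\{u\in L^{\frac{2N}{N-2s}}(\mathbb R^N):\ \iint_{\mathbb R^{2N}}\frac{|u(x)-u(y)|^2}{|x-y|^{N+2s}}\,dx\,dy<\infty\Big\}.$$ For $\rho>0$ let $H^s_{c,\rho}(\mathbb R^N)$ be the set of all $\varphi\in\dot H^s(\mathbb R^N)$ with $\varphi\ge0$, with compact support, and with $\varphi=0$ in $B_\rho(0)$. A function $v\in \dot H^s(\mathbb R^N)\cap C(\mathbb R^N)$ is called a weak supersolution (resp. weak subsolution) of $(-\Delta)^s v+Vv=g$ in $\mathbb R^N\setminus B_\rho(0)$ if $$\iint_{\mathbb R^{2N}}\frac{(v(x)-v(y))(\varphi(x)-\varphi(y))}{|x-y|^{N+2s}}\,dx\,dy+\int_{\mathbb R^N}Vv\varphi\,dx\ \ge\ \int_{\mathbb R^N}g\varphi\,dx\qquad(\text{resp. }\le)$$ for all $\varphi\in H^s_{c,\rho}(\mathbb R^N)$ such that $g\varphi$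 is integrable. Let $R,R',\lambda>0$, let $f\in L^1_{\mathrm{loc}}(\mathbb R^N\setminus\{0\})$ with $f\ge0$ almost everywhere, let $\tilde v\in\dot H^s(\mathbb R^N)\cap C(\mathbb R^N)$, $\tilde v>0$, be a weak supersolution of $(-\Delta)^s v+Vv=f$ in $\mathbb R^N\setminus B_R(0)$, and let $\underline v_\lambda\in\dot H^s(\mathbb R^N)\cap C(\mathbb R^N)$, $\underline v_\lambda>0$, be a weak subsolution of $(-\Delta)^s v+Vv=\lambda f$ in $\mathbb R^N\setminus B_{R'}(0)$. Put $\tilde R:=\max\{R,R'\}$. Then $$\tilde v\ \ge\ C\,\underline v_\lambda\qquad\text{on }\mathbb R^N,$$ where $C>0$ is a constant depending only on $\lambda$, $\min_{\overline{B_{\tilde R}(0)}}\tilde v$ and $\max_{\overline{B_{\tilde R}(0)}}\underline v_\lambda$. -/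

import Mathlib

open MeasureTheory Set

/-- The homogeneous fractional Sobolev space on `ℝ^N` (used for `N > 2s`): functions in
`L^{2N/(N-2s)}` with finite Gagliardo seminorm
`[u]_s^2 = ∬ |u x - u y|^2 / |x - y|^(N+2s) dx dy`. -/
structure MemHDot {N : ℕ} (s : ℝ) (u : EuclideanSpace ℝ (Fin N) → ℝ) : Prop where
  memLp : MemLp u (ENNReal.ofReal (2 * N / (N - 2 * s))) volume
  seminorm_finite : Integrable
    (fun p : EuclideanSpace ℝ (Fin N) × EuclideanSpace ℝ (Fin N) =>
      (u p.1 - u p.2) ^ 2 / ‖p.1 - p.2‖ ^ ((N : ℝ) + 2 * s)) (volume.prod volume)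

/-- The bilinear form
`∬ (u x - u y) (φ x - φ y) / |x - y|^(N+2s) dx dy = ∫ (-Δ)^(s/2) u (-Δ)^(s/2) φ`,
with the normalization `(-Δ)^s u x = 2 PV ∫ (u x - u y) / |x - y|^(N+2s) dy`.
The integrand is integrable for `u`, `φ` in the homogeneous space, by Cauchy-Schwarz. -/
noncomputable def fracForm {N : ℕ} (s : ℝ) (u φ : EuclideanSpace ℝ (Fin N) → ℝ) : ℝ :=
  ∫ p : EuclideanSpace ℝ (Fin N) × EuclideanSpace ℝ (Fin N),
    (u p.1 - u p.2) * (φ p.1 - φ p.2) / ‖p.1 - p.2‖ ^ ((N : ℝ) + 2 * s) ∂(volume.prod volume)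

/-- Test functions for weak sub- and supersolutions outside the ball `B_R(0)`: nonnegative
functions of the homogeneous space with compact support that vanish in `B_R(0)`. -/
structure IsExteriorTest {N : ℕ} (s R : ℝ) (φ : EuclideanSpace ℝ (Fin N) → ℝ) : Prop where
  memHDot : MemHDot s φ
  nonneg : ∀ x, 0 ≤ φ x
  hasCompactSupport : HasCompactSupport φ
  eq_zero : ∀ x ∈ Metric.ball (0 : EuclideanSpace ℝ (Fin N)) R, φ x = 0

/-- `v` is a weak supersolution of `(-Δ)^s v + V v = g` in `ℝ^N \ B_R(0)`.
As `g` is only locally integrable and test functions may be unbounded, the inequality is asked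
for exactly those test functions that `g` pairs with. -/
def IsWeakSupersolution {N : ℕ} (s : ℝ) (V g : EuclideanSpace ℝ (Fin N) → ℝ) (R : ℝ)
    (v : EuclideanSpace ℝ (Fin N) → ℝ) : Prop :=
  MemHDot s v ∧ ∀ φ : EuclideanSpace ℝ (Fin N) → ℝ, IsExteriorTest s R φ →
    Integrable (fun x => g x * φ x) volume →
    ∫ x, g x * φ x ≤ fracForm s v φ + ∫ x, V x * v x * φ x

/-- `v` is a weak subsolution of `(-Δ)^s v + V v = g` in `ℝ^N \ B_R(0)`, with the same
convention on test functions. -/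
def IsWeakSubsolution {N : ℕ} (s : ℝ) (V g : EuclideanSpace ℝ (Fin N) → ℝ) (R : ℝ)
    (v : EuclideanSpace ℝ (Fin N) → ℝ) : Prop :=
  MemHDot s v ∧ ∀ φ : EuclideanSpace ℝ (Fin N) → ℝ, IsExteriorTest s R φ →
    Integrable (fun x => g x * φ x) volume →
    fracForm s v φ + ∫ x, V x * v x * φ x ≤ ∫ x, g x * φ x

/-! Take `C = min (m / M) (1 / lam)` and `w = C * vsub - vsup`. The choice of `m / M` gives `w ≤ 0`
on the closed ball of radius `max R R'`, so `u = max w 0` vanishes there. The choice of `1 / lam`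
makes `w` a subsolution with right-hand side `(C * lam - 1) * f ≤ 0` outside. Testing formally with
`u` would force its seminorm to vanish, since the potential term also has the good sign.

Test functions need compact support, so `w` is tested with `η² u`, where `η = ballCutoff r`. The
Caccioppoli inequality `lintegral_gagliardo_cutoff_mul_le` then bounds the energy of `η u` by the
commutator `∫ u² Γ(η)`, with `Γ = gagliardoDensity s`. Here `Γ(η) ≤ c r^(-2s)` pointwise, while the
norm of `Γ(η)` in `L^(N/(2s))` is bounded uniformly in `r`. Since `u²` lies in the dual space
`L^(N/(N-2s))`, the commutator tends to `0`
(`tendsto_lintegral_sq_mul_gagliardoDensity_ballCutoff`). Hence `u` is constant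
(`eq_of_tendsto_lintegral_gagliardo`), and it is zero at the origin. -/

/-! ### The truncated kernel: integrability and scaling -/

/-- The Gagliardo kernel `|h|^{-(N+2s)}` truncated by `min 1 |h|^2` is integrable. -/
theorem integrable_min_norm_sq_div {N : ℕ} {s : ℝ} (hs : 0 < s) (hs1 : s < 1) (hN : 0 < N) :
    Integrable (fun h : EuclideanSpace ℝ (Fin N) =>
      min 1 (‖h‖ ^ 2) / ‖h‖ ^ ((N : ℝ) + 2 * s)) volume := by
  have : Nonempty (Fin N) := ⟨⟨0, hN⟩⟩
  have key := integrable_fun_norm_addHaar (volume : Measure (EuclideanSpace ℝ (Fin N)))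
    (f := fun y : ℝ => min 1 (y ^ 2) / y ^ ((N : ℝ) + 2 * s))
  refine key.2 ?_
  rw [finrank_euclideanSpace_fin]
  have hpow : ∀ y : ℝ, 0 < y → y ^ (N - 1) = y ^ ((N : ℝ) - 1) := by
    intro y hy
    rw [← Real.rpow_natCast, Nat.cast_sub hN, Nat.cast_one]
  -- In polar coordinates the integrand is `y^(1-2s)` up to radius 1, integrable because `s < 1`,
  -- and `y^(-1-2s)` beyond, integrable because `0 < s`.
  have hsplit : Ioi (0 : ℝ) = Ioc 0 1 ∪ Ioi 1 := (Ioc_union_Ioi_eq_Ioi zero_le_one).symm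
  rw [hsplit]
  refine IntegrableOn.union ?_ ?_
  · have h1 : IntegrableOn (fun y : ℝ => y ^ (1 - 2 * s)) (Ioc 0 1) := by
      rw [integrableOn_Ioc_iff_integrableOn_Ioo, intervalIntegral.integrableOn_Ioo_rpow_iff one_pos]
      linarith
    refine h1.congr_fun (fun y hy => ?_) measurableSet_Ioc
    have hy0 : 0 < y := hy.1
    have : min 1 (y ^ 2) = y ^ (2 : ℝ) := by
      rw [Real.rpow_two]
      exact min_eq_right (by nlinarith [hy.2])
    simp only [smul_eq_mul]
    rw [this, hpow y hy0, ← Real.rpow_sub hy0, ← Real.rpow_add hy0]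
    congr 1; ring
  · have h1 : IntegrableOn (fun y : ℝ => y ^ (-1 - 2 * s)) (Ioi 1) :=
      integrableOn_Ioi_rpow_of_lt (by linarith) one_pos
    refine h1.congr_fun (fun y hy => ?_) measurableSet_Ioi
    have hy1 : 1 < y := hy
    have hy0 : 0 < y := by linarith
    have : min 1 (y ^ 2) = 1 := min_eq_left (by nlinarith)
    simp only [smul_eq_mul]
    rw [this, hpow y hy0, one_div, ← Real.rpow_neg hy0.le, ← Real.rpow_add hy0]
    congr 1; ring

/-- Scaling of the truncated Gagliardo kernel. -/
theorem lintegral_min_norm_sq_div_scale {N : ℕ} (s : ℝ) {r : ℝ} (hr : 0 < r) :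
    ∫⁻ h : EuclideanSpace ℝ (Fin N),
        ENNReal.ofReal (min 1 (‖h‖ ^ 2 / r ^ 2) / ‖h‖ ^ ((N : ℝ) + 2 * s)) =
      ENNReal.ofReal (r ^ (-(2 * s))) * ∫⁻ h : EuclideanSpace ℝ (Fin N),
        ENNReal.ofReal (min 1 (‖h‖ ^ 2) / ‖h‖ ^ ((N : ℝ) + 2 * s)) := by
  set F : EuclideanSpace ℝ (Fin N) → ENNReal := fun h =>
    ENNReal.ofReal (min 1 (‖h‖ ^ 2 / r ^ 2) / ‖h‖ ^ ((N : ℝ) + 2 * s)) with hF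
  have hFm : Measurable F := by fun_prop
  have hmap := Measure.map_addHaar_smul (volume : Measure (EuclideanSpace ℝ (Fin N))) hr.ne'
  have h1 : ∫⁻ z, F (r • z) = ENNReal.ofReal ((r ^ N)⁻¹) * ∫⁻ h, F h := by
    rw [← lintegral_map (f := F) (g := fun z => r • z) hFm (measurable_const_smul r), hmap,
      lintegral_smul_measure, finrank_euclideanSpace_fin, abs_of_pos (by positivity), smul_eq_mul]
  have h2 : ∀ z, F (r • z) = ENNReal.ofReal (r ^ (-((N : ℝ) + 2 * s))) *
      ENNReal.ofReal (min 1 (‖z‖ ^ 2) / ‖z‖ ^ ((N : ℝ) + 2 * s)) := by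
    intro z
    rw [← ENNReal.ofReal_mul (by positivity)]
    simp only [hF]
    congr 1
    rw [norm_smul, Real.norm_of_nonneg hr.le, mul_pow, mul_div_cancel_left₀ _ (by positivity),
      Real.mul_rpow hr.le (norm_nonneg z), Real.rpow_neg hr.le, div_mul_eq_div_div, div_eq_mul_inv,
      div_eq_mul_inv, div_eq_mul_inv]
    ring
  have h3 : ENNReal.ofReal (r ^ N) * ENNReal.ofReal ((r ^ N)⁻¹) = 1 := by
    rw [← ENNReal.ofReal_mul (by positivity), mul_inv_cancel₀ (by positivity), ENNReal.ofReal_one]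
  calc ∫⁻ h, F h = ENNReal.ofReal (r ^ N) * ∫⁻ z, F (r • z) := by
        rw [h1, ← mul_assoc, h3, one_mul]
    _ = _ := by
        simp_rw [h2]
        rw [lintegral_const_mul' _ _ ENNReal.ofReal_ne_top, ← mul_assoc,
          ← ENNReal.ofReal_mul (by positivity), ← Real.rpow_natCast, ← Real.rpow_add hr]
        congr 3; ring

/-! ### Energy density of a cutoff at scale `r` -/

/-- The pointwise energy density (carré du champ) of the Gagliardo seminorm. -/
noncomputable def gagliardoDensity {N : ℕ} (s : ℝ) (η : EuclideanSpace ℝ (Fin N) → ℝ)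
    (x : EuclideanSpace ℝ (Fin N)) : ENNReal :=
  ∫⁻ y, ENNReal.ofReal ((η x - η y) ^ 2 / ‖x - y‖ ^ ((N : ℝ) + 2 * s))

theorem measurable_gagliardoDensity {N : ℕ} (s : ℝ) {η : EuclideanSpace ℝ (Fin N) → ℝ}
    (hη : Continuous η) : Measurable (gagliardoDensity s η) := by
  have := hη.measurable
  exact Measurable.lintegral_prod_right' (f := fun p : EuclideanSpace ℝ (Fin N) ×
    EuclideanSpace ℝ (Fin N) =>
      ENNReal.ofReal ((η p.1 - η p.2) ^ 2 / ‖p.1 - p.2‖ ^ ((N : ℝ) + 2 * s))) (by fun_prop)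

/-- The total mass of the truncated Gagliardo kernel. -/
noncomputable def kernelMass (N : ℕ) (s : ℝ) : ENNReal :=
  ∫⁻ h : EuclideanSpace ℝ (Fin N), ENNReal.ofReal (min 1 (‖h‖ ^ 2) / ‖h‖ ^ ((N : ℝ) + 2 * s))

theorem kernelMass_ne_top {N : ℕ} {s : ℝ} (hs : 0 < s) (hs1 : s < 1) (hN : 0 < N) :
    kernelMass N s ≠ ⊤ :=
  (integrable_min_norm_sq_div hs hs1 hN).lintegral_lt_top.ne

theorem gagliardoDensity_le {N : ℕ} (s : ℝ) {r : ℝ} (hr : 0 < r)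
    {η : EuclideanSpace ℝ (Fin N) → ℝ}
    (hη : ∀ x y, (η x - η y) ^ 2 ≤ min 1 (‖x - y‖ ^ 2 / r ^ 2)) (x : EuclideanSpace ℝ (Fin N)) :
    gagliardoDensity s η x ≤ ENNReal.ofReal (r ^ (-(2 * s))) * kernelMass N s := by
  rw [kernelMass, ← lintegral_min_norm_sq_div_scale s hr,
    ← lintegral_sub_left_eq_self (μ := (volume : Measure (EuclideanSpace ℝ (Fin N)))) _ x]
  exact lintegral_mono fun y => ENNReal.ofReal_le_ofReal (by gcongr; exact hη x y)

/-- The Gagliardo double integral is symmetric, so a weight in the second variable can be moved to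
the first. -/
theorem lintegral_lintegral_weight_swap {N : ℕ} (s : ℝ) {η : EuclideanSpace ℝ (Fin N) → ℝ}
    (hη : Measurable η) {w : EuclideanSpace ℝ (Fin N) → ENNReal} (hw : Measurable w) :
    ∫⁻ x, ∫⁻ y, w y * ENNReal.ofReal ((η x - η y) ^ 2 / ‖x - y‖ ^ ((N : ℝ) + 2 * s)) =
      ∫⁻ x, w x * gagliardoDensity s η x := by
  rw [lintegral_lintegral_swap (by fun_prop)]
  refine lintegral_congr fun x => ?_
  rw [gagliardoDensity, ← lintegral_const_mul _ (by fun_prop)]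
  refine lintegral_congr fun y => ?_
  rw [norm_sub_rev x y, ← neg_sub (η x) (η y), neg_sq]

/-- The double integrand vanishes when both points lie outside the support ball, so it is dominated
by the part with `x` in the ball plus the part with `y` in the ball. These are equal by symmetry,
and each is controlled by the pointwise bound. -/
theorem lintegral_gagliardoDensity_le {N : ℕ} (s : ℝ) {r : ℝ} (hr : 0 < r)
    {η : EuclideanSpace ℝ (Fin N) → ℝ} (hc : Continuous η)
    (hη : ∀ x y, (η x - η y) ^ 2 ≤ min 1 (‖x - y‖ ^ 2 / r ^ 2))
    (hsupp : ∀ x, x ∉ Metric.closedBall (0 : EuclideanSpace ℝ (Fin N)) (2 * r) → η x = 0) :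
    ∫⁻ x, gagliardoDensity s η x ≤
      2 * (volume (Metric.closedBall (0 : EuclideanSpace ℝ (Fin N)) (2 * r)) *
        (ENNReal.ofReal (r ^ (-(2 * s))) * kernelMass N s)) := by
  set K := Metric.closedBall (0 : EuclideanSpace ℝ (Fin N)) (2 * r)
  have hK : MeasurableSet K := measurableSet_closedBall
  have hm := hc.measurable
  set w : EuclideanSpace ℝ (Fin N) → ENNReal := K.indicator 1 with hw
  have hwm : Measurable w := measurable_one.indicator hK
  have hpt : ∀ x y, ENNReal.ofReal ((η x - η y) ^ 2 / ‖x - y‖ ^ ((N : ℝ) + 2 * s)) ≤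
      w x * ENNReal.ofReal ((η x - η y) ^ 2 / ‖x - y‖ ^ ((N : ℝ) + 2 * s)) +
      w y * ENNReal.ofReal ((η x - η y) ^ 2 / ‖x - y‖ ^ ((N : ℝ) + 2 * s)) := by
    intro x y
    by_cases hx : x ∈ K
    · simp [hw, hx]
    · by_cases hy : y ∈ K
      · simp [hw, hy]
      · simp [hsupp x hx, hsupp y hy]
  have hone : ∫⁻ x, w x * gagliardoDensity s η x ≤
      volume K * (ENNReal.ofReal (r ^ (-(2 * s))) * kernelMass N s) := by
    calc ∫⁻ x, w x * gagliardoDensity s η x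
        ≤ ∫⁻ x, w x * (ENNReal.ofReal (r ^ (-(2 * s))) * kernelMass N s) :=
          lintegral_mono fun x => by gcongr; exact gagliardoDensity_le s hr hη x
      _ = _ := by rw [lintegral_mul_const _ hwm, hw, lintegral_indicator_one hK]
  calc ∫⁻ x, gagliardoDensity s η x
      ≤ ∫⁻ x, ((∫⁻ y, w x * ENNReal.ofReal ((η x - η y) ^ 2 / ‖x - y‖ ^ ((N : ℝ) + 2 * s))) +
        ∫⁻ y, w y * ENNReal.ofReal ((η x - η y) ^ 2 / ‖x - y‖ ^ ((N : ℝ) + 2 * s))) := by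
        refine lintegral_mono fun x => ?_
        rw [← lintegral_add_left (by fun_prop)]
        exact lintegral_mono (hpt x)
    _ = (∫⁻ x, w x * gagliardoDensity s η x) + ∫⁻ x, w x * gagliardoDensity s η x := by
        have h1 : ∀ x, ∫⁻ y, w x * ENNReal.ofReal ((η x - η y) ^ 2 / ‖x - y‖ ^ ((N : ℝ) + 2 * s)) =
            w x * gagliardoDensity s η x := fun x => lintegral_const_mul _ (by fun_prop)
        simp_rw [h1]
        have h2 : Measurable fun x => w x * gagliardoDensity s η x :=
          hwm.mul (measurable_gagliardoDensity s hc)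
        rw [lintegral_add_left h2, lintegral_lintegral_weight_swap s hm hwm]
    _ ≤ _ := by rw [two_mul]; gcongr

/-- Interpolation between the `L^∞` and `L^1` bounds. At the exponent `N / (2s)` the volume factor
`r^N` is exactly cancelled by the power of `r^(-2s)`, so the result is independent of `r`. -/
theorem lintegral_gagliardoDensity_rpow_le {N : ℕ} {s : ℝ} (hs : 0 < s) (hN : 2 * s < N) {r : ℝ}
    (hr : 0 < r) {η : EuclideanSpace ℝ (Fin N) → ℝ} (hc : Continuous η)
    (hη : ∀ x y, (η x - η y) ^ 2 ≤ min 1 (‖x - y‖ ^ 2 / r ^ 2))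
    (hsupp : ∀ x, x ∉ Metric.closedBall (0 : EuclideanSpace ℝ (Fin N)) (2 * r) → η x = 0) :
    ∫⁻ x, gagliardoDensity s η x ^ ((N : ℝ) / (2 * s)) ≤
      2 * (ENNReal.ofReal (2 ^ N) *
        volume (Metric.ball (0 : EuclideanSpace ℝ (Fin N)) 1) *
        kernelMass N s ^ ((N : ℝ) / (2 * s))) := by
  set q : ℝ := (N : ℝ) / (2 * s) with hq
  have hq1 : 1 < q := by rw [hq, lt_div_iff₀ (by positivity)]; linarith
  set M := ENNReal.ofReal (r ^ (-(2 * s))) * kernelMass N s with hM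
  have hsplit : ∀ a : ENNReal, a ^ q = a * a ^ (q - 1) := by
    intro a
    conv_rhs => rw [← ENNReal.rpow_one a, ← ENNReal.rpow_mul, one_mul]
    rw [← ENNReal.rpow_add_of_nonneg _ _ zero_le_one (by linarith)]
    congr 1; ring
  have hm := measurable_gagliardoDensity s hc
  have hMq : ENNReal.ofReal (r ^ N) * M ^ q = kernelMass N s ^ q := by
    rw [hM, ENNReal.mul_rpow_of_nonneg _ _ (by linarith),
      ENNReal.ofReal_rpow_of_pos (by positivity), ← mul_assoc, ← ENNReal.ofReal_mul (by positivity),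
      ← Real.rpow_mul hr.le, ← Real.rpow_natCast, ← Real.rpow_add hr]
    have : (N : ℝ) + -(2 * s) * q = 0 := by rw [hq]; field_simp; ring
    rw [this, Real.rpow_zero, ENNReal.ofReal_one, one_mul]
  calc ∫⁻ x, gagliardoDensity s η x ^ q
      ≤ ∫⁻ x, gagliardoDensity s η x * M ^ (q - 1) := by
        refine lintegral_mono fun x => ?_
        rw [hsplit]
        gcongr
        exact gagliardoDensity_le s hr hη x
    _ = (∫⁻ x, gagliardoDensity s η x) * M ^ (q - 1) := lintegral_mul_const _ hm
    _ ≤ 2 * (volume (Metric.closedBall (0 : EuclideanSpace ℝ (Fin N)) (2 * r)) * M) *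
          M ^ (q - 1) := by
        gcongr; exact lintegral_gagliardoDensity_le s hr hc hη hsupp
    _ = 2 * (ENNReal.ofReal (2 ^ N) * volume (Metric.ball (0 : EuclideanSpace ℝ (Fin N)) 1) *
          (ENNReal.ofReal (r ^ N) * M ^ q)) := by
        rw [Measure.addHaar_closedBall _ _ (by positivity), finrank_euclideanSpace_fin, mul_pow,
          ENNReal.ofReal_mul (by positivity), hsplit M]
        ring
    _ = _ := by rw [hMq]

/-- The constant in the Hölder estimate of `∫ u² Γ(η)`, which does not depend on the scale of the
cutoff `η`. -/
noncomputable def densityBound (N : ℕ) (s : ℝ) : ENNReal :=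
  (2 * (ENNReal.ofReal (2 ^ N) * volume (Metric.ball (0 : EuclideanSpace ℝ (Fin N)) 1) *
    kernelMass N s ^ ((N : ℝ) / (2 * s)))) ^ (1 / ((N : ℝ) / (2 * s)))

theorem densityBound_ne_top {N : ℕ} {s : ℝ} (hs : 0 < s) (hs1 : s < 1) (hN : 0 < N) :
    densityBound N s ≠ ⊤ := by
  have := kernelMass_ne_top hs hs1 hN
  refine ENNReal.rpow_ne_top_of_nonneg (by positivity) ?_
  refine ENNReal.mul_ne_top (by simp) (ENNReal.mul_ne_top (ENNReal.mul_ne_top (by simp) ?_) ?_)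
  · exact measure_ball_lt_top.ne
  · exact ENNReal.rpow_ne_top_of_nonneg (by positivity) this

/-- `∫ w Γ(η)` is estimated on a ball by `Γ(η) ≤ c r^{-2s}` and outside of it by Hölder's
inequality. -/
theorem lintegral_mul_gagliardoDensity_le {N : ℕ} {s : ℝ} (hs : 0 < s) (hN : 2 * s < N) {r : ℝ}
    (hr : 0 < r) {η : EuclideanSpace ℝ (Fin N) → ℝ} (hc : Continuous η)
    (hη : ∀ x y, (η x - η y) ^ 2 ≤ min 1 (‖x - y‖ ^ 2 / r ^ 2))
    (hsupp : ∀ x, x ∉ Metric.closedBall (0 : EuclideanSpace ℝ (Fin N)) (2 * r) → η x = 0)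
    {w : EuclideanSpace ℝ (Fin N) → ENNReal} (hw : Measurable w) (A : ℝ) :
    ∫⁻ x, w x * gagliardoDensity s η x ≤
      (∫⁻ x in Metric.closedBall 0 A, w x) * (ENNReal.ofReal (r ^ (-(2 * s))) * kernelMass N s) +
      (∫⁻ x in (Metric.closedBall 0 A)ᶜ, w x ^ ((N : ℝ) / (N - 2 * s))) ^
        (1 / ((N : ℝ) / (N - 2 * s))) * densityBound N s := by
  have hm := measurable_gagliardoDensity s hc
  have hN0 : (0 : ℝ) < N := by linarith
  have hN2 : (0 : ℝ) < N - 2 * s := by linarith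
  rw [← lintegral_add_compl _ (measurableSet_closedBall (x := (0 : EuclideanSpace ℝ (Fin N)))
    (ε := A))]
  gcongr ?_ + ?_
  · rw [← lintegral_mul_const _ hw]
    refine lintegral_mono fun x => ?_
    gcongr
    exact gagliardoDensity_le s hr hη x
  · have hconj : ((N : ℝ) / (N - 2 * s)).HolderConjugate ((N : ℝ) / (2 * s)) := by
      rw [Real.holderConjugate_iff]
      refine ⟨by rw [lt_div_iff₀ hN2]; linarith, ?_⟩
      rw [inv_div, inv_div]; field_simp; ring
    refine (ENNReal.lintegral_mul_le_Lp_mul_Lq _ hconj hw.aemeasurable hm.aemeasurable).trans ?_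
    rw [densityBound]
    gcongr
    exact (setLIntegral_le_lintegral _ _).trans
      (lintegral_gagliardoDensity_rpow_le hs hN hr hc hη hsupp)

/-! ### The cutoff function -/

/-- The Lipschitz cutoff at scale `r`. -/
noncomputable def ballCutoff {N : ℕ} (r : ℝ) (x : EuclideanSpace ℝ (Fin N)) : ℝ :=
  max 0 (min 1 (2 - ‖x‖ / r))

section ballCutoff

variable {N : ℕ} {r : ℝ}

theorem continuous_ballCutoff : Continuous (ballCutoff r : EuclideanSpace ℝ (Fin N) → ℝ) := by
  unfold ballCutoff; fun_prop

theorem ballCutoff_nonneg (x : EuclideanSpace ℝ (Fin N)) : 0 ≤ ballCutoff r x := le_max_left _ _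

theorem ballCutoff_le_one (x : EuclideanSpace ℝ (Fin N)) : ballCutoff r x ≤ 1 :=
  max_le zero_le_one (min_le_left _ _)

theorem ballCutoff_eq_zero (hr : 0 < r) (x : EuclideanSpace ℝ (Fin N))
    (hx : x ∉ Metric.closedBall (0 : EuclideanSpace ℝ (Fin N)) (2 * r)) : ballCutoff r x = 0 := by
  rw [mem_closedBall_zero_iff, not_le] at hx
  refine max_eq_left ((min_le_right _ _).trans ?_)
  rw [sub_nonpos, le_div_iff₀ hr]
  exact hx.le

theorem ballCutoff_eq_one (hr : 0 < r) {x : EuclideanSpace ℝ (Fin N)} (hx : ‖x‖ ≤ r) :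
    ballCutoff r x = 1 := by
  have : ‖x‖ / r ≤ 1 := (div_le_one hr).2 hx
  rw [ballCutoff, min_eq_left (by linarith), max_eq_right zero_le_one]

theorem sq_ballCutoff_sub_le (hr : 0 < r) (x y : EuclideanSpace ℝ (Fin N)) :
    (ballCutoff r x - ballCutoff r y) ^ 2 ≤ min 1 (‖x - y‖ ^ 2 / r ^ 2) := by
  refine le_min ?_ ?_
  · rw [sq_le_one_iff_abs_le_one, abs_le]
    constructor <;>
      linarith [ballCutoff_nonneg (r := r) x, ballCutoff_le_one (r := r) x,
        ballCutoff_nonneg (r := r) y, ballCutoff_le_one (r := r) y]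
  · rw [← div_pow, ← sq_abs]
    refine pow_le_pow_left₀ (abs_nonneg _) ?_ 2
    calc |ballCutoff r x - ballCutoff r y|
        ≤ |min 1 (2 - ‖x‖ / r) - min 1 (2 - ‖y‖ / r)| := by
          simpa [ballCutoff] using
            abs_max_sub_max_le_max 0 (min 1 (2 - ‖x‖ / r)) 0 (min 1 (2 - ‖y‖ / r))
      _ ≤ |(2 - ‖x‖ / r) - (2 - ‖y‖ / r)| := by
          simpa using abs_min_sub_min_le_max 1 (2 - ‖x‖ / r) 1 (2 - ‖y‖ / r)
      _ = |‖x‖ - ‖y‖| / r := by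
          rw [← abs_of_pos hr, ← abs_div, abs_of_pos hr, ← abs_neg]; congr 1; ring
      _ ≤ ‖x - y‖ / r := by gcongr; exact abs_norm_sub_norm_le x y

end ballCutoff

/-! ### Vanishing of the commutator -/

/-- The commutator term `∫ u² Γ(η_r)` is finite, and tends to `0` as the cutoff `η_r` exhausts the
space. -/
theorem lintegral_sq_mul_gagliardoDensity_ballCutoff_ne_top {N : ℕ} {s : ℝ} (hs : 0 < s)
    (hs1 : s < 1) (hN : 2 * s < N) {u : EuclideanSpace ℝ (Fin N) → ℝ} (hu : Continuous u)
    (hfin : ∫⁻ x, ENNReal.ofReal (u x ^ 2) ^ ((N : ℝ) / (N - 2 * s)) ≠ ⊤) {r : ℝ} (hr : 0 < r) :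
    ∫⁻ x, ENNReal.ofReal (u x ^ 2) * gagliardoDensity s (ballCutoff r) x ≠ ⊤ := by
  have hN0 : 0 < N := by rw [← Nat.cast_pos (α := ℝ)]; linarith
  have hN2 : (0 : ℝ) < N - 2 * s := by linarith
  -- Radius `-1` makes the ball empty, so Hölder's inequality is applied on the whole space.
  refine ne_top_of_le_ne_top ?_ (lintegral_mul_gagliardoDensity_le hs hN hr continuous_ballCutoff
    (sq_ballCutoff_sub_le hr) (ballCutoff_eq_zero hr)
    (w := fun x => ENNReal.ofReal (u x ^ 2)) (by fun_prop) (-1))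
  simp only [Metric.closedBall_eq_empty.2 (show (-1 : ℝ) < 0 by norm_num), Measure.restrict_empty,
    lintegral_zero_measure, zero_mul, zero_add, compl_empty, Measure.restrict_univ]
  exact ENNReal.mul_ne_top (ENNReal.rpow_ne_top_of_nonneg (by positivity) hfin)
    (densityBound_ne_top hs hs1 hN0)

-- The constant multiplying the tail of `u²` does not depend on `r`. A large ball can therefore be
-- fixed to make the tail small for all `r` at once; on that ball the factor `r^(-2s)` gives the
-- decay.
open Filter Topology in
theorem tendsto_lintegral_sq_mul_gagliardoDensity_ballCutoff {N : ℕ} {s : ℝ} (hs : 0 < s)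
    (hs1 : s < 1) (hN : 2 * s < N) {u : EuclideanSpace ℝ (Fin N) → ℝ} (hu : Continuous u)
    (hfin : ∫⁻ x, ENNReal.ofReal (u x ^ 2) ^ ((N : ℝ) / (N - 2 * s)) ≠ ⊤) :
    Tendsto (fun r : ℝ => ∫⁻ x, ENNReal.ofReal (u x ^ 2) * gagliardoDensity s (ballCutoff r) x)
      atTop (𝓝 0) := by
  have hN0 : 0 < N := by rw [← Nat.cast_pos (α := ℝ)]; linarith
  have hN2 : (0 : ℝ) < N - 2 * s := by linarith
  have hNR : (0 : ℝ) < N := Nat.cast_pos.2 hN0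
  set q : ℝ := (N : ℝ) / (N - 2 * s) with hq
  have hq0 : 0 < q := by positivity
  have hwm : Measurable fun x => ENNReal.ofReal (u x ^ 2) := by fun_prop
  -- the tails of the Lebesgue norm vanish
  have htail : Tendsto (fun n : ℕ => ∫⁻ x in (Metric.closedBall 0 (n : ℝ))ᶜ,
      ENNReal.ofReal (u x ^ 2) ^ q) atTop (𝓝 0) := by
    have h := tendsto_lintegral_of_dominated_convergence
      (μ := (volume : Measure (EuclideanSpace ℝ (Fin N))))
      (F := fun (n : ℕ) => ((Metric.closedBall 0 (n : ℝ))ᶜ).indicator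
        (fun x => ENNReal.ofReal (u x ^ 2) ^ q)) (f := fun _ => 0)
      (fun x => ENNReal.ofReal (u x ^ 2) ^ q)
      (fun n => (hwm.pow_const q).indicator measurableSet_closedBall.compl)
      (fun n => ae_of_all _ fun x => indicator_le_self _ _ x) hfin
      (ae_of_all _ fun x => by
        obtain ⟨k, hk⟩ := exists_nat_ge ‖x‖
        refine tendsto_const_nhds.congr' ?_
        filter_upwards [eventually_ge_atTop k] with n hn
        rw [indicator_of_notMem]
        rw [mem_compl_iff, not_not, mem_closedBall_zero_iff]
        exact hk.trans (by exact_mod_cast hn))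
    rw [lintegral_zero] at h
    refine h.congr fun n => ?_
    rw [lintegral_indicator measurableSet_closedBall.compl]
  have htail' : Tendsto (fun n : ℕ => (∫⁻ x in (Metric.closedBall 0 (n : ℝ))ᶜ,
      ENNReal.ofReal (u x ^ 2) ^ q) ^ (1 / q) * densityBound N s) atTop (𝓝 0) := by
    have := ENNReal.Tendsto.mul_const (b := densityBound N s) (htail.ennrpow_const (1 / q))
      (Or.inr (densityBound_ne_top hs hs1 hN0))
    rwa [ENNReal.zero_rpow_of_pos (by positivity), zero_mul] at this
  rw [ENNReal.tendsto_nhds_zero]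
  intro ε hε
  obtain ⟨n, hn⟩ := ((ENNReal.tendsto_nhds_zero.1 htail') (ε / 2) (ENNReal.half_pos hε.ne')).exists
  have hball : ∫⁻ x in Metric.closedBall 0 (n : ℝ), ENNReal.ofReal (u x ^ 2) ≠ ⊤ :=
    ((hu.pow 2).continuousOn.integrableOn_compact
      (isCompact_closedBall (0 : EuclideanSpace ℝ (Fin N)) n)).lintegral_lt_top.ne
  have hhead : Tendsto (fun r : ℝ => (∫⁻ x in Metric.closedBall 0 (n : ℝ),
      ENNReal.ofReal (u x ^ 2)) * (ENNReal.ofReal (r ^ (-(2 * s))) * kernelMass N s))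
      atTop (𝓝 0) := by
    have h1 : Tendsto (fun r : ℝ => ENNReal.ofReal (r ^ (-(2 * s)))) atTop (𝓝 0) := by
      have := ENNReal.tendsto_ofReal (tendsto_rpow_neg_atTop (show 0 < 2 * s by positivity))
      rwa [ENNReal.ofReal_zero] at this
    have h2 := ENNReal.Tendsto.const_mul (a := ∫⁻ x in Metric.closedBall 0 (n : ℝ),
      ENNReal.ofReal (u x ^ 2)) (ENNReal.Tendsto.mul_const (b := kernelMass N s) h1
      (Or.inr (kernelMass_ne_top hs hs1 hN0))) (Or.inr hball)
    rwa [zero_mul, mul_zero] at h2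
  filter_upwards [(ENNReal.tendsto_nhds_zero.1 hhead) (ε / 2) (ENNReal.half_pos hε.ne'),
    eventually_gt_atTop 0] with r hr hr0
  refine (lintegral_mul_gagliardoDensity_le hs hN hr0 continuous_ballCutoff
    (sq_ballCutoff_sub_le hr0) (ballCutoff_eq_zero hr0) hwm n).trans ?_
  rw [← ENNReal.add_halves ε]
  exact add_le_add hr hn

/-! ### Integrability, Caccioppoli inequality, and constancy at zero energy -/

section

variable {N : ℕ} {s : ℝ}

/-- By `|AB| ≤ A² + B²`. This ensures that `fracForm` is a genuine integral rather than the default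
value `0`, and so can be split linearly. -/
theorem integrable_gagliardo_mul {a b : EuclideanSpace ℝ (Fin N) → ℝ} (ha : Continuous a)
    (hb : Continuous b)
    (hia : Integrable (fun p : EuclideanSpace ℝ (Fin N) × EuclideanSpace ℝ (Fin N) =>
      (a p.1 - a p.2) ^ 2 / ‖p.1 - p.2‖ ^ ((N : ℝ) + 2 * s)) (volume.prod volume))
    (hib : Integrable (fun p : EuclideanSpace ℝ (Fin N) × EuclideanSpace ℝ (Fin N) =>
      (b p.1 - b p.2) ^ 2 / ‖p.1 - p.2‖ ^ ((N : ℝ) + 2 * s)) (volume.prod volume)) :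
    Integrable (fun p : EuclideanSpace ℝ (Fin N) × EuclideanSpace ℝ (Fin N) =>
      (a p.1 - a p.2) * (b p.1 - b p.2) / ‖p.1 - p.2‖ ^ ((N : ℝ) + 2 * s))
      (volume.prod volume) := by
  have hma := ha.measurable
  have hmb := hb.measurable
  refine (hia.add hib).mono' (Measurable.aestronglyMeasurable (by fun_prop))
    (ae_of_all _ fun p => ?_)
  have hD : 0 ≤ ‖p.1 - p.2‖ ^ ((N : ℝ) + 2 * s) := by positivity
  rw [norm_div, Real.norm_of_nonneg hD, Pi.add_apply, ← add_div, Real.norm_eq_abs, abs_mul]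
  gcongr
  nlinarith [sq_nonneg (|a p.1 - a p.2| - |b p.1 - b p.2|), sq_abs (a p.1 - a p.2),
    sq_abs (b p.1 - b p.2), abs_nonneg (a p.1 - a p.2), abs_nonneg (b p.1 - b p.2)]

theorem fracForm_const_mul_sub {a b φ : EuclideanSpace ℝ (Fin N) → ℝ} (C : ℝ)
    (ha : Continuous a) (hb : Continuous b) (hφ : Continuous φ)
    (hHa : MemHDot s a) (hHb : MemHDot s b) (hHφ : MemHDot s φ) :
    fracForm s (fun x => C * a x - b x) φ = C * fracForm s a φ - fracForm s b φ := by
  unfold fracForm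
  rw [← integral_const_mul, ← integral_sub
    ((integrable_gagliardo_mul ha hφ hHa.seminorm_finite hHφ.seminorm_finite).const_mul C)
    (integrable_gagliardo_mul hb hφ hHb.seminorm_finite hHφ.seminorm_finite)]
  congr 1; ext p; ring

/-- The positive part of a combination of continuous functions of finite seminorm. -/
theorem MemHDot.posPart_const_mul_sub {a b : EuclideanSpace ℝ (Fin N) → ℝ} (C : ℝ)
    (ha : Continuous a) (hb : Continuous b) (hHa : MemHDot s a) (hHb : MemHDot s b) :
    MemHDot s (fun x => max (C * a x - b x) 0) := by
  have hma := ha.measurable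
  have hmb := hb.measurable
  refine ⟨?_, ?_⟩
  · refine ((hHa.memLp.const_mul C).sub hHb.memLp).mono
      (Measurable.aestronglyMeasurable (by fun_prop)) (ae_of_all _ fun x => ?_)
    rw [Real.norm_of_nonneg (le_max_right _ _), Pi.sub_apply]
    exact max_le (le_abs_self _) (abs_nonneg _)
  · refine ((hHa.seminorm_finite.const_mul (2 * C ^ 2)).add
      (hHb.seminorm_finite.const_mul 2)).mono'
      (Measurable.aestronglyMeasurable (by fun_prop)) (ae_of_all _ fun p => ?_)
    have hD : 0 ≤ ‖p.1 - p.2‖ ^ ((N : ℝ) + 2 * s) := by positivity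
    rw [Real.norm_of_nonneg (by positivity), Pi.add_apply, ← mul_div_assoc, ← mul_div_assoc,
      ← add_div]
    gcongr
    have h1 : |max (C * a p.1 - b p.1) 0 - max (C * a p.2 - b p.2) 0| ≤
        |(C * a p.1 - b p.1) - (C * a p.2 - b p.2)| := by
      simpa using abs_max_sub_max_le_max (C * a p.1 - b p.1) 0 (C * a p.2 - b p.2) 0
    nlinarith [sq_le_sq.2 h1, sq_nonneg (C * (a p.1 - a p.2) + (b p.1 - b p.2))]

theorem MemHDot.lintegral_rpow_ne_top {u : EuclideanSpace ℝ (Fin N) → ℝ} (hN : 2 * s < N)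
    (hN0 : 0 < N) (hu : MemHDot s u) :
    ∫⁻ x, ENNReal.ofReal (u x ^ 2) ^ ((N : ℝ) / (N - 2 * s)) ≠ ⊤ := by
  have hN2 : (0 : ℝ) < N - 2 * s := by linarith
  have hNR : (0 : ℝ) < N := Nat.cast_pos.2 hN0
  have hp : 0 < 2 * (N : ℝ) / (N - 2 * s) := by positivity
  have h := lintegral_rpow_enorm_lt_top_of_eLpNorm_lt_top (by simpa using hp)
    ENNReal.ofReal_ne_top hu.memLp.eLpNorm_lt_top
  rw [ENNReal.toReal_ofReal hp.le] at h
  refine ne_of_lt (lt_of_le_of_lt (le_of_eq (lintegral_congr fun x => ?_)) h)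
  rw [← sq_abs, ENNReal.ofReal_pow (abs_nonneg _), ← Real.enorm_eq_ofReal_abs,
    ← ENNReal.rpow_natCast, ← ENNReal.rpow_mul]
  congr 1; push_cast; ring

theorem lintegral_prod_sq_mul_eq {u η : EuclideanSpace ℝ (Fin N) → ℝ} (hu : Continuous u)
    (hη : Continuous η) :
    ∫⁻ p : EuclideanSpace ℝ (Fin N) × EuclideanSpace ℝ (Fin N),
        ENNReal.ofReal (u p.1 ^ 2 * ((η p.1 - η p.2) ^ 2 / ‖p.1 - p.2‖ ^ ((N : ℝ) + 2 * s)))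
        ∂(volume.prod volume) =
      ∫⁻ x, ENNReal.ofReal (u x ^ 2) * gagliardoDensity s η x := by
  have hmu := hu.measurable
  have hmη := hη.measurable
  rw [lintegral_prod _ (by fun_prop)]
  refine lintegral_congr fun x => ?_
  rw [gagliardoDensity, ← lintegral_const_mul _ (by fun_prop)]
  exact lintegral_congr fun y => ENNReal.ofReal_mul (sq_nonneg _)

theorem integrable_sq_mul_gagliardo {u η : EuclideanSpace ℝ (Fin N) → ℝ} (hu : Continuous u)
    (hη : Continuous η)
    (hfin : ∫⁻ x, ENNReal.ofReal (u x ^ 2) * gagliardoDensity s η x ≠ ⊤) :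
    Integrable (fun p : EuclideanSpace ℝ (Fin N) × EuclideanSpace ℝ (Fin N) =>
      u p.1 ^ 2 * ((η p.1 - η p.2) ^ 2 / ‖p.1 - p.2‖ ^ ((N : ℝ) + 2 * s)))
      (volume.prod volume) := by
  have hmu := hu.measurable
  have hmη := hη.measurable
  refine ⟨Measurable.aestronglyMeasurable (by fun_prop), ?_⟩
  rw [hasFiniteIntegral_iff_ofReal (ae_of_all _ fun p => by positivity),
    lintegral_prod_sq_mul_eq hu hη]
  exact hfin.lt_top

/-- If `ζ` is bounded by `1` and is controlled by `η`, then multiplication with `ζ` preserves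
finiteness of the Gagliardo seminorm. -/
theorem integrable_gagliardo_cutoff_mul {u η ζ : EuclideanSpace ℝ (Fin N) → ℝ} (hu : Continuous u)
    (hη : Continuous η) (hζ : Continuous ζ) (hζ1 : ∀ x, ζ x ^ 2 ≤ 1)
    (hζη : ∀ x y, (ζ x - ζ y) ^ 2 ≤ 4 * (η x - η y) ^ 2)
    (hiu : Integrable (fun p : EuclideanSpace ℝ (Fin N) × EuclideanSpace ℝ (Fin N) =>
      (u p.1 - u p.2) ^ 2 / ‖p.1 - p.2‖ ^ ((N : ℝ) + 2 * s)) (volume.prod volume))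
    (hfin : ∫⁻ x, ENNReal.ofReal (u x ^ 2) * gagliardoDensity s η x ≠ ⊤) :
    Integrable (fun p : EuclideanSpace ℝ (Fin N) × EuclideanSpace ℝ (Fin N) =>
      (ζ p.1 * u p.1 - ζ p.2 * u p.2) ^ 2 / ‖p.1 - p.2‖ ^ ((N : ℝ) + 2 * s))
      (volume.prod volume) := by
  have hmu := hu.measurable
  have hmζ := hζ.measurable
  -- The increment of `ζ u` is `ζ(y) (u(x) - u(y)) + u(x) (ζ(x) - ζ(y))`. Squaring the sum costs a
  -- factor 2 on each term, and `hζη` contributes the further factor 4.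
  refine ((hiu.const_mul 2).add ((integrable_sq_mul_gagliardo hu hη hfin).const_mul 8)).mono'
    (Measurable.aestronglyMeasurable (by fun_prop)) (ae_of_all _ fun p => ?_)
  rw [Real.norm_of_nonneg (by positivity), Pi.add_apply, ← mul_div_assoc, ← mul_div_assoc,
    ← mul_div_assoc, ← add_div]
  gcongr
  have h1 : (ζ p.2 * (u p.1 - u p.2)) ^ 2 ≤ (u p.1 - u p.2) ^ 2 := by
    rw [mul_pow]; exact mul_le_of_le_one_left (sq_nonneg _) (hζ1 _)
  have h2 : (u p.1 * (ζ p.1 - ζ p.2)) ^ 2 ≤ u p.1 ^ 2 * (4 * (η p.1 - η p.2) ^ 2) := by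
    rw [mul_pow]; exact mul_le_mul_of_nonneg_left (hζη _ _) (sq_nonneg _)
  nlinarith [sq_nonneg (ζ p.2 * (u p.1 - u p.2) - u p.1 * (ζ p.1 - ζ p.2))]

/-- For `A = max a 0` and `B = max b 0`, the identity `(αA - βB)² = (A - B)(α²A - β²B) + AB(α - β)²`
holds, and `AB ≤ (A² + B²)/2`. Replacing `A - B` by `a - b` only increases the product, because the
negative part of each number meets only the positive part of the other. -/
theorem sq_sub_le_posPart_cutoff (a b α β : ℝ) :
    (α * max a 0 - β * max b 0) ^ 2 ≤
      (a - b) * (α ^ 2 * max a 0 - β ^ 2 * max b 0) +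
        (max a 0 ^ 2 * (α - β) ^ 2 + max b 0 ^ 2 * (α - β) ^ 2) / 2 := by
  rcases le_total 0 a with ha | ha <;> rcases le_total 0 b with hb | hb <;>
    simp only [max_eq_left, max_eq_right, ha, hb]
  · nlinarith [mul_nonneg (sq_nonneg (a - b)) (sq_nonneg (α - β))]
  · nlinarith [mul_nonneg (mul_nonneg ha (neg_nonneg.2 hb)) (sq_nonneg α),
      mul_nonneg (sq_nonneg a) (sq_nonneg (α - β))]
  · nlinarith [mul_nonneg (mul_nonneg hb (neg_nonneg.2 ha)) (sq_nonneg β),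
      mul_nonneg (sq_nonneg b) (sq_nonneg (α - β))]
  · simp

/-- Caccioppoli inequality for the positive part of a weak subsolution. -/
theorem lintegral_gagliardo_cutoff_mul_le {w η : EuclideanSpace ℝ (Fin N) → ℝ} (hw : Continuous w)
    (hη : Continuous η) (hη1 : ∀ x, η x ^ 2 ≤ 1)
    (hiu : Integrable (fun p : EuclideanSpace ℝ (Fin N) × EuclideanSpace ℝ (Fin N) =>
      (max (w p.1) 0 - max (w p.2) 0) ^ 2 / ‖p.1 - p.2‖ ^ ((N : ℝ) + 2 * s)) (volume.prod volume))
    (hfin : ∫⁻ x, ENNReal.ofReal (max (w x) 0 ^ 2) * gagliardoDensity s η x ≠ ⊤)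
    (hint : Integrable (fun p : EuclideanSpace ℝ (Fin N) × EuclideanSpace ℝ (Fin N) =>
      (w p.1 - w p.2) * (η p.1 ^ 2 * max (w p.1) 0 - η p.2 ^ 2 * max (w p.2) 0) /
        ‖p.1 - p.2‖ ^ ((N : ℝ) + 2 * s)) (volume.prod volume))
    (hform : fracForm s w (fun x => η x ^ 2 * max (w x) 0) ≤ 0) :
    ∫⁻ p : EuclideanSpace ℝ (Fin N) × EuclideanSpace ℝ (Fin N),
        ENNReal.ofReal ((η p.1 * max (w p.1) 0 - η p.2 * max (w p.2) 0) ^ 2 /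
          ‖p.1 - p.2‖ ^ ((N : ℝ) + 2 * s)) ∂(volume.prod volume) ≤
      ∫⁻ x, ENNReal.ofReal (max (w x) 0 ^ 2) * gagliardoDensity s η x := by
  have hu : Continuous fun x => max (w x) 0 := by fun_prop
  have hP := integrable_sq_mul_gagliardo (s := s) hu hη hfin
  have hE := integrable_gagliardo_cutoff_mul hu hη hη hη1
    (fun x y => by nlinarith [sq_nonneg (η x - η y)]) hiu hfin
  rw [← lintegral_prod_sq_mul_eq (s := s) hu hη,
    ← ofReal_integral_eq_lintegral_ofReal hE (ae_of_all _ fun p => by positivity),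
    ← ofReal_integral_eq_lintegral_ofReal hP (ae_of_all _ fun p => by positivity)]
  refine ENNReal.ofReal_le_ofReal ?_
  -- The pointwise inequality carries half the weight at each of the two points; the swap merges
  -- both halves into one integral weighted at the first point.
  have hswap := integral_prod_swap (μ := (volume : Measure (EuclideanSpace ℝ (Fin N))))
    (ν := (volume : Measure (EuclideanSpace ℝ (Fin N))))
    (fun p => max (w p.1) 0 ^ 2 * ((η p.1 - η p.2) ^ 2 / ‖p.1 - p.2‖ ^ ((N : ℝ) + 2 * s)))
  have hPs := hP.swap
  calc _ ≤ ∫ p : EuclideanSpace ℝ (Fin N) × EuclideanSpace ℝ (Fin N),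
        ((w p.1 - w p.2) * (η p.1 ^ 2 * max (w p.1) 0 - η p.2 ^ 2 * max (w p.2) 0) /
          ‖p.1 - p.2‖ ^ ((N : ℝ) + 2 * s) +
        (max (w p.1) 0 ^ 2 * ((η p.1 - η p.2) ^ 2 / ‖p.1 - p.2‖ ^ ((N : ℝ) + 2 * s)) / 2 +
        max (w p.swap.1) 0 ^ 2 * ((η p.swap.1 - η p.swap.2) ^ 2 /
          ‖p.swap.1 - p.swap.2‖ ^ ((N : ℝ) + 2 * s)) / 2)) ∂(volume.prod volume) := by
        refine integral_mono hE (hint.add ((hP.div_const 2).add (hPs.div_const 2))) fun p => ?_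
        simp only [Prod.fst_swap, Prod.snd_swap]
        rw [norm_sub_rev p.2 p.1, ← neg_sub (η p.1) (η p.2), neg_sq]
        have hD : 0 ≤ ‖p.1 - p.2‖ ^ ((N : ℝ) + 2 * s) := by positivity
        refine (div_le_div_of_nonneg_right
          (sq_sub_le_posPart_cutoff (w p.1) (w p.2) (η p.1) (η p.2)) hD).trans_eq ?_
        ring
    _ = fracForm s w (fun x => η x ^ 2 * max (w x) 0) +
        ∫ p : EuclideanSpace ℝ (Fin N) × EuclideanSpace ℝ (Fin N),
          max (w p.1) 0 ^ 2 * ((η p.1 - η p.2) ^ 2 / ‖p.1 - p.2‖ ^ ((N : ℝ) + 2 * s))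
          ∂(volume.prod volume) := by
        refine (integral_add hint ((hP.div_const 2).add (hPs.div_const 2))).trans ?_
        refine congrArg₂ (· + ·) rfl
          ((integral_add (hP.div_const 2) (hPs.div_const 2)).trans ?_)
        rw [integral_div, integral_div]
        exact (congrArg (_ / 2 + · / 2) hswap).trans (add_halves _)
    _ ≤ _ := by linarith

/-- A continuous function whose truncations have Gagliardo energy tending to `0` is constant. -/
theorem eq_of_tendsto_lintegral_gagliardo {u : EuclideanSpace ℝ (Fin N) → ℝ} (hu : Continuous u)
    {e : ℝ → ENNReal} (he : Filter.Tendsto e Filter.atTop (nhds 0))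
    (hle : ∀ r : ℝ, 0 < r → ∫⁻ p : EuclideanSpace ℝ (Fin N) × EuclideanSpace ℝ (Fin N),
        ENNReal.ofReal ((ballCutoff r p.1 * u p.1 - ballCutoff r p.2 * u p.2) ^ 2 /
          ‖p.1 - p.2‖ ^ ((N : ℝ) + 2 * s)) ∂(volume.prod volume) ≤ e r)
    (x y : EuclideanSpace ℝ (Fin N)) : u x = u y := by
  have hmu := hu.measurable
  set K : ℝ := ‖x‖ + ‖y‖ + 1 with hK
  set U : Set (EuclideanSpace ℝ (Fin N) × EuclideanSpace ℝ (Fin N)) :=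
    Metric.ball 0 K ×ˢ Metric.ball 0 K with hU
  have hUo : IsOpen U := Metric.isOpen_ball.prod Metric.isOpen_ball
  have hzero : ∫⁻ p in U, ENNReal.ofReal ((u p.1 - u p.2) ^ 2 /
      ‖p.1 - p.2‖ ^ ((N : ℝ) + 2 * s)) ∂(volume.prod volume) = 0 := by
    refine le_antisymm (ge_of_tendsto he ?_) zero_le
    filter_upwards [Filter.eventually_ge_atTop K] with r hr
    have hr0 : 0 < r := lt_of_lt_of_le (by positivity) hr
    refine le_trans ?_ (hle r hr0)
    refine le_trans (le_of_eq ?_) (setLIntegral_le_lintegral U _)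
    refine setLIntegral_congr_fun hUo.measurableSet fun p hp => ?_
    have h1 := mem_ball_zero_iff.1 hp.1
    have h2 := mem_ball_zero_iff.1 hp.2
    rw [ballCutoff_eq_one hr0 (h1.le.trans hr), ballCutoff_eq_one hr0 (h2.le.trans hr), one_mul,
      one_mul]
  rw [lintegral_eq_zero_iff (by fun_prop)] at hzero
  have hae : (fun p : EuclideanSpace ℝ (Fin N) × EuclideanSpace ℝ (Fin N) => u p.1)
      =ᵐ[(volume.prod volume).restrict U] fun p => u p.2 := by
    filter_upwards [hzero] with p hp
    by_cases hxy : p.1 = p.2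
    · rw [hxy]
    · have hD : 0 < ‖p.1 - p.2‖ ^ ((N : ℝ) + 2 * s) :=
        Real.rpow_pos_of_pos (norm_pos_iff.2 (sub_ne_zero.2 hxy)) _
      have h := ENNReal.ofReal_eq_zero.1 hp
      rw [div_le_iff₀ hD, zero_mul] at h
      exact sub_eq_zero.1 (pow_eq_zero_iff two_ne_zero |>.1 (le_antisymm h (sq_nonneg _)))
  -- Two continuous functions that agree almost everywhere on an open set agree everywhere on it, in
  -- particular at `(x, y)`.
  have heq := Measure.eqOn_open_of_ae_eq hae hUo (by fun_prop) (by fun_prop)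
  refine heq (x := (x, y)) ⟨?_, ?_⟩ <;> rw [mem_ball_zero_iff] <;>
    linarith [norm_nonneg x, norm_nonneg y]

end

/-! ### Admissible test functions and the Liouville-type conclusion -/

section

variable {N : ℕ} {s : ℝ}

/-- The cutoff enters squared because the Caccioppoli inequality is obtained by testing with `η² u`.
Since `0 ≤ η ≤ 1`, squared increments of `η²` are at most 4 times those of `η`, so the seminorm
stays finite. -/
theorem isExteriorTest_cutoff_mul {u : EuclideanSpace ℝ (Fin N) → ℝ} {ρ r : ℝ} (hs : 0 < s)
    (hs1 : s < 1) (hN : 2 * s < N) (hr : 0 < r) (hu : Continuous u) (hu0 : ∀ x, 0 ≤ u x)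
    (hHu : MemHDot s u) (hzero : ∀ x ∈ Metric.ball (0 : EuclideanSpace ℝ (Fin N)) ρ, u x = 0) :
    IsExteriorTest s ρ (fun x => ballCutoff r x ^ 2 * u x) := by
  have hN0 : 0 < N := by rw [← Nat.cast_pos (α := ℝ)]; linarith
  have hη : Continuous (ballCutoff r : EuclideanSpace ℝ (Fin N) → ℝ) := continuous_ballCutoff
  have hc : Continuous fun x => ballCutoff r x ^ 2 * u x := by fun_prop
  have hcs : HasCompactSupport fun x => ballCutoff r x ^ 2 * u x :=
    HasCompactSupport.intro (isCompact_closedBall (0 : EuclideanSpace ℝ (Fin N)) (2 * r))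
      fun x hx => by rw [ballCutoff_eq_zero hr x hx]; ring
  refine ⟨⟨hc.memLp_of_hasCompactSupport hcs, ?_⟩, fun x => mul_nonneg (sq_nonneg _) (hu0 x), hcs,
    fun x hx => by rw [hzero x hx, mul_zero]⟩
  refine integrable_gagliardo_cutoff_mul (ζ := fun x => ballCutoff r x ^ 2) hu hη (hη.pow 2) (fun x => ?_) (fun x y => ?_)
    hHu.seminorm_finite (lintegral_sq_mul_gagliardoDensity_ballCutoff_ne_top hs hs1 hN hu
      (hHu.lintegral_rpow_ne_top hN hN0) hr)
  · exact pow_le_one₀ (sq_nonneg _) (pow_le_one₀ (ballCutoff_nonneg x) (ballCutoff_le_one x))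
  · have hx0 := ballCutoff_nonneg (r := r) x
    have hx1 := ballCutoff_le_one (r := r) x
    have hy0 := ballCutoff_nonneg (r := r) y
    have hy1 := ballCutoff_le_one (r := r) y
    have h : (ballCutoff r x + ballCutoff r y) ^ 2 ≤ 4 := by nlinarith
    calc (ballCutoff r x ^ 2 - ballCutoff r y ^ 2) ^ 2
        = (ballCutoff r x + ballCutoff r y) ^ 2 * (ballCutoff r x - ballCutoff r y) ^ 2 := by ring
      _ ≤ _ := mul_le_mul_of_nonneg_right h (sq_nonneg _)

/-- A continuous function vanishing near the origin and with compact support pairs with every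
function that is locally integrable away from the origin. -/
theorem integrable_mul_of_locallyIntegrableOn_compl {f φ : EuclideanSpace ℝ (Fin N) → ℝ} {ρ : ℝ}
    (hρ : 0 < ρ) (hf : LocallyIntegrableOn f ({0}ᶜ : Set (EuclideanSpace ℝ (Fin N))) volume)
    (hφ : Continuous φ) (hcs : HasCompactSupport φ)
    (hzero : ∀ x ∈ Metric.ball (0 : EuclideanSpace ℝ (Fin N)) ρ, φ x = 0) :
    Integrable (fun x => f x * φ x) volume := by
  have hsub : tsupport φ ⊆ ({0}ᶜ : Set (EuclideanSpace ℝ (Fin N))) := by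
    rw [subset_compl_singleton_iff, notMem_tsupport_iff_eventuallyEq]
    filter_upwards [Metric.ball_mem_nhds 0 hρ] with x hx using hzero x hx
  have hK : IsCompact (tsupport φ) := hcs
  have hfK : IntegrableOn f (tsupport φ) volume := hf.integrableOn_compact_subset hsub hK
  have h := hfK.mul_continuousOn hφ.continuousOn hK
  refine (integrableOn_iff_integrable_of_support_subset fun x hx => ?_).1 h
  exact subset_tsupport φ (Function.mem_support.2 (right_ne_zero_of_mul hx))

/-- A difference `C a - b` that is a weak subsolution against its own truncated positive part, and
is nonpositive at some point, is nonpositive. -/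
theorem const_mul_le_of_fracForm_nonpos {a b : EuclideanSpace ℝ (Fin N) → ℝ} {C : ℝ} (hs : 0 < s)
    (hs1 : s < 1) (hN : 2 * s < N) (ha : Continuous a) (hb : Continuous b) (hHa : MemHDot s a)
    (hHb : MemHDot s b) (z : EuclideanSpace ℝ (Fin N)) (hz : C * a z ≤ b z)
    (hform : ∀ r : ℝ, 0 < r →
      MemHDot s (fun x => ballCutoff r x ^ 2 * max (C * a x - b x) 0) ∧
      fracForm s (fun x => C * a x - b x)
        (fun x => ballCutoff r x ^ 2 * max (C * a x - b x) 0) ≤ 0)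
    (x : EuclideanSpace ℝ (Fin N)) : C * a x ≤ b x := by
  have hN0 : 0 < N := by rw [← Nat.cast_pos (α := ℝ)]; linarith
  have hw : Continuous fun x => C * a x - b x := by fun_prop
  have hu : Continuous fun x => max (C * a x - b x) 0 := by fun_prop
  have hHu := MemHDot.posPart_const_mul_sub C ha hb hHa hHb
  have hfin := hHu.lintegral_rpow_ne_top hN hN0
  have henergy : ∀ r : ℝ, 0 < r →
      ∫⁻ p : EuclideanSpace ℝ (Fin N) × EuclideanSpace ℝ (Fin N),
        ENNReal.ofReal ((ballCutoff r p.1 * max (C * a p.1 - b p.1) 0 -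
          ballCutoff r p.2 * max (C * a p.2 - b p.2) 0) ^ 2 /
          ‖p.1 - p.2‖ ^ ((N : ℝ) + 2 * s)) ∂(volume.prod volume) ≤
      ∫⁻ x, ENNReal.ofReal (max (C * a x - b x) 0 ^ 2) *
        gagliardoDensity s (ballCutoff r) x := by
    intro r hr
    have hη : Continuous (ballCutoff r : EuclideanSpace ℝ (Fin N) → ℝ) := continuous_ballCutoff
    obtain ⟨hHφ, hle⟩ := hform r hr
    have hφ : Continuous fun x => ballCutoff r x ^ 2 * max (C * a x - b x) 0 := by fun_prop
    have h1 := (integrable_gagliardo_mul ha hφ hHa.seminorm_finite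
      hHφ.seminorm_finite).const_mul C
    have h2 := integrable_gagliardo_mul hb hφ hHb.seminorm_finite hHφ.seminorm_finite
    have hη1 : ∀ x : EuclideanSpace ℝ (Fin N), ballCutoff r x ^ 2 ≤ 1 := fun x =>
      pow_le_one₀ (ballCutoff_nonneg x) (ballCutoff_le_one x)
    refine lintegral_gagliardo_cutoff_mul_le (w := fun x => C * a x - b x) hw hη hη1
      hHu.seminorm_finite
      (lintegral_sq_mul_gagliardoDensity_ballCutoff_ne_top hs hs1 hN hu hfin hr) ?_ hle
    refine (h1.sub h2).congr (ae_of_all _ fun p => ?_)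
    simp only [Pi.sub_apply]
    ring
  have hconst := eq_of_tendsto_lintegral_gagliardo (s := s)
    (u := fun x => max (C * a x - b x) 0) hu
    (tendsto_lintegral_sq_mul_gagliardoDensity_ballCutoff hs hs1 hN hu hfin) henergy x z
  rw [max_eq_right (sub_nonpos.2 hz)] at hconst
  have := le_max_left (C * a x - b x) 0
  linarith

end

/-! ### The comparison principle -/

/-- Quantifying `C` before `N`, `s`, `V`, `f` and the radii expresses that it depends only on `lam`,
the minimum `m` and the maximum `M`. -/
theorem lemma5p1 (lam m M : ℝ) (hlam : 0 < lam) (hm : 0 < m) (hM : 0 < M) :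
    ∃ C : ℝ, 0 < C ∧
      ∀ (N : ℕ) (s : ℝ), 0 < s → s < 1 → 2 * s < (N : ℝ) →
      ∀ V : EuclideanSpace ℝ (Fin N) → ℝ, Continuous V → (∀ x, 0 ≤ V x) →
      ∀ f : EuclideanSpace ℝ (Fin N) → ℝ,
        LocallyIntegrableOn f ({0}ᶜ : Set (EuclideanSpace ℝ (Fin N))) volume →
        (∀ᵐ x ∂(volume : Measure (EuclideanSpace ℝ (Fin N))), 0 ≤ f x) →
      ∀ R R' : ℝ, 0 < R → 0 < R' →
      ∀ vsup vsub : EuclideanSpace ℝ (Fin N) → ℝ,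
        Continuous vsup → (∀ x, 0 < vsup x) → IsWeakSupersolution s V f R vsup →
        Continuous vsub → (∀ x, 0 < vsub x) →
          IsWeakSubsolution s V (fun x => lam * f x) R' vsub →
        IsLeast (vsup '' Metric.closedBall 0 (max R R')) m →
        IsGreatest (vsub '' Metric.closedBall 0 (max R R')) M →
        ∀ x, C * vsub x ≤ vsup x := by
  refine ⟨min (m / M) (1 / lam), by positivity, ?_⟩
  intro N s hs hs1 hN V hV hV0 f hf hf0 R R' hR hR' vsup vsub hcsup _ hsup hcsub hsub0 hsub hleast
    hgreatest
  set C := min (m / M) (1 / lam) with hC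
  have hC0 : 0 < C := by positivity
  have hball : ∀ x ∈ Metric.closedBall (0 : EuclideanSpace ℝ (Fin N)) (max R R'),
      C * vsub x ≤ vsup x := by
    intro x hx
    calc C * vsub x ≤ m / M * M := by
          gcongr
          · exact (hsub0 x).le
          · exact min_le_left _ _
          · exact hgreatest.2 (mem_image_of_mem _ hx)
      _ = m := div_mul_cancel₀ _ hM.ne'
      _ ≤ vsup x := hleast.2 (mem_image_of_mem _ hx)
  have hClam : C * lam ≤ 1 := by
    calc C * lam ≤ 1 / lam * lam := by gcongr; exact min_le_right _ _
      _ = 1 := by field_simp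
  have hρ : 0 < max R R' := lt_max_of_lt_left hR
  refine const_mul_le_of_fracForm_nonpos hs hs1 hN hcsub hcsup hsub.1 hsup.1 0
    (hball 0 (Metric.mem_closedBall_self hρ.le)) fun r hr => ?_
  set u : EuclideanSpace ℝ (Fin N) → ℝ := fun x => max (C * vsub x - vsup x) 0 with hu
  have huc : Continuous u := by fun_prop
  have hHu : MemHDot s u := MemHDot.posPart_const_mul_sub C hcsub hcsup hsub.1 hsup.1
  set φ : EuclideanSpace ℝ (Fin N) → ℝ := fun x => ballCutoff r x ^ 2 * u x with hφ
  have hη : Continuous (ballCutoff r : EuclideanSpace ℝ (Fin N) → ℝ) := continuous_ballCutoff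
  have hφc : Continuous φ := by fun_prop
  -- The same function must be admissible for both inequalities, whose excluded balls may have
  -- different radii.
  have htest : ∀ ρ ≤ max R R', IsExteriorTest s ρ φ := fun ρ hle =>
    isExteriorTest_cutoff_mul hs hs1 hN hr huc (fun x => le_max_right _ _) hHu fun x hx =>
      max_eq_right (sub_nonpos.2 (hball x (Metric.closedBall_subset_closedBall hle
        (Metric.ball_subset_closedBall hx))))
  have hT := htest _ le_rfl
  have hfφ : Integrable (fun x => f x * φ x) volume :=
    integrable_mul_of_locallyIntegrableOn_compl hρ hf hφc hT.hasCompactSupport hT.eq_zero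
  refine ⟨hT.memHDot, ?_⟩
  have h1 := hsup.2 φ (htest R (le_max_left _ _)) hfφ
  have h2 := hsub.2 φ (htest R' (le_max_right _ _))
    ((hfφ.const_mul lam).congr (ae_of_all _ fun x => by ring))
  have h3 : ∫ x, lam * f x * φ x = lam * ∫ x, f x * φ x := by
    rw [← integral_const_mul]; congr 1; ext x; ring
  have hint : ∀ v : EuclideanSpace ℝ (Fin N) → ℝ, Continuous v →
      Integrable (fun x => V x * v x * φ x) volume := fun v hv =>
    (show Continuous fun x => V x * v x * φ x by fun_prop).integrable_of_hasCompactSupport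
      (hT.hasCompactSupport.mul_left)
  -- The integrand is `V η² w max(w, 0)`, which is nonnegative.
  have h4 : 0 ≤ C * (∫ x, V x * vsub x * φ x) - ∫ x, V x * vsup x * φ x := by
    rw [← integral_const_mul, ← integral_sub ((hint vsub hcsub).const_mul C) (hint vsup hcsup)]
    refine integral_nonneg fun x => ?_
    have hw : 0 ≤ (C * vsub x - vsup x) * u x := by
      rcases le_total 0 (C * vsub x - vsup x) with h | h
      · exact mul_nonneg h (le_max_right _ _)
      · simp only [hu, max_eq_right h, mul_zero, le_refl]
    have : C * (V x * vsub x * φ x) - V x * vsup x * φ x =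
        V x * ballCutoff r x ^ 2 * ((C * vsub x - vsup x) * u x) := by simp only [hφ]; ring
    simp only [Pi.zero_apply]
    rw [this]
    exact mul_nonneg (mul_nonneg (hV0 x) (sq_nonneg _)) hw
  have h5 : 0 ≤ ∫ x, f x * φ x :=
    integral_nonneg_of_ae (by filter_upwards [hf0] with x hx using mul_nonneg hx (hT.nonneg x))
  rw [fracForm_const_mul_sub C hcsub hcsup hφc hsub.1 hsup.1 hT.memHDot]
  rw [h3] at h2
  -- `C` times the subsolution inequality minus the supersolution inequality bounds the form by `(C
  -- * lam - 1) ∫ f φ` minus the nonnegative quantity in `h4`.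
  nlinarith [mul_le_mul_of_nonneg_left h2 hC0.le, mul_le_mul_of_nonneg_right hClam h5]
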